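/- Let $p:\mathbb C\to\mathbb R$ be a subharmonic, nonharmonic polynomial in $x_1,x_2$ ($z=x_1+ix_2$) and let $\tau\in\mathbb R$. Let $\bar Z_{\tau p}=\frac{\partial}{\partial\bar z}+\tau\frac{\partial p}{\partial\bar z}$, with $\frac{\partial}{\partial\bar z}=\frac12\big(\frac{\partial}{\partial x_1}+i\frac{\partial}{\partial x_2}\big)$, be the closed, densely defined operator on $L^2(\mathbb C)$ whose domain consists of all $f\in L^2(\mathbb C)$ for which $\bar Z_{\tau p}f$, taken in the sense of distributions, lies in $L^2(\mathbb C)$. Let $Z_{\tau p}=-\bar Z_{\tau p}^{*}$ be the negative of its Hilbert space adjoint (formally $\frac{\partial}{\partial z}-\tau\frac{\partial p}{\partial z}$), and let $\Box_{\tau p}=-\bar Z_{\tau p}Z_{\tau p}$ and $\tilde\Box_{\tau p}=-Z_{\tau p}\bar Z_{\tau p}$, all compositions of operators being taken on their natural domains. These are nonnegative self-adjoint operators; let $e^{-s\Box_{\tau p}}$ and $e^{-s\tilde\Box_{\tau p}}$, $s\ge 0$, be their heat semigroups on $L^2(\mathbb C)$, defined by the spectral theorem. Then for every $s\ge0$ \[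 e^{-s\Box_{\tau p}}\bar Z_{\tau p}=\bar Z_{\tau p}e^{-s\tilde\Box_{\tau p}} \qquad\text{and}\qquad e^{-s\tilde\Box_{\tau p}}Z_{\tau p}=Z_{\tau p}e^{-s\Box_{\tau p}} \] in the following sense. If $f\in\operatorname{Dom}\bar Z_{\tau p}$, then $e^{-s\tilde\Box_{\tau p}}f\in\operatorname{Dom}\bar Z_{\tau p}$ and $\bar Z_{\tau p}e^{-s\tilde\Box_{\tau p}}f=e^{-s\Box_{\tau p}}\bar Z_{\tau p}f$; moreover $\bar Z_{\tau p}e^{-s\tilde\Box_{\tau p}}$ is the closure of $e^{-s\Box_{\tau p}}\bar Z_{\tau p}$, and for $s>0$ it is defined on all of $L^2(\mathbb C)$. Likewise, if $f\in\operatorname{Dom}Z_{\tau p}$, then $e^{-s\Box_{\tau p}}f\in\operatorname{Dom}Z_{\tau p}$ and $Z_{\tau p}e^{-s\Box_{\tau p}}f=e^{-s\tilde\Box_{\tau p}}Z_{\tau p}f$; moreover $Z_{\tau p}e^{-s\Box_{\tau p}}$ is the closure of $e^{-s\tilde\Box_{\tau p}}Z_{\tau p}$, and for $s>0$ it is defined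 on all of $L^2(\mathbb C)$. -/

import Mathlib

open MeasureTheory
open scoped ENNReal ContDiff LinearPMap

noncomputable section

/-! ### Unbounded operators: composition, resolvent at `-1`, heat semigroup -/

/-- The composition `g ∘ f` of unbounded operators on its natural domain
`{x ∈ Dom f : f x ∈ Dom g}`. -/
def pcomp {E F G : Type*} [AddCommGroup E] [Module ℂ E] [AddCommGroup F] [Module ℂ F]
    [AddCommGroup G] [Module ℂ G] (g : F →ₗ.[ℂ] G) (f : E →ₗ.[ℂ] F) : E →ₗ.[ℂ] G where
  domain :=
    { carrier := {x | ∃ h : x ∈ f.domain, f ⟨x, h⟩ ∈ g.domain}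
      zero_mem' := ⟨f.domain.zero_mem, by
        have h : f ⟨0, f.domain.zero_mem⟩ = 0 := f.map_zero
        rw [h]; exact g.domain.zero_mem⟩
      add_mem' := by
        rintro x y ⟨hx, hx'⟩ ⟨hy, hy'⟩
        refine ⟨f.domain.add_mem hx hy, ?_⟩
        have h : f ⟨x + y, f.domain.add_mem hx hy⟩ = f ⟨x, hx⟩ + f ⟨y, hy⟩ :=
          f.map_add ⟨x, hx⟩ ⟨y, hy⟩
        rw [h]; exact g.domain.add_mem hx' hy'
      smul_mem' := by
        rintro c x ⟨hx, hx'⟩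
        refine ⟨f.domain.smul_mem c hx, ?_⟩
        have h : f ⟨c • x, f.domain.smul_mem c hx⟩ = c • f ⟨x, hx⟩ := f.map_smul c ⟨x, hx⟩
        rw [h]; exact g.domain.smul_mem c hx' }
  toFun :=
    { toFun := fun x => g ⟨f ⟨x.1, x.2.fst⟩, x.2.snd⟩
      map_add' := fun x y => by
        rw [← g.map_add]
        exact congrArg g (Subtype.ext (f.map_add ⟨x.1, x.2.fst⟩ ⟨y.1, y.2.fst⟩))
      map_smul' := fun c x => by
        rw [RingHom.id_apply, ← g.map_smul]
        exact congrArg g (Subtype.ext (f.map_smul c ⟨x.1, x.2.fst⟩)) }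

section Heat

set_option linter.unusedSectionVars false

variable {H K : Type*} [NormedAddCommGroup H] [InnerProductSpace ℂ H] [CompleteSpace H]
  [NormedAddCommGroup K] [InnerProductSpace ℂ K] [CompleteSpace K]

/-- `R` is the bounded everywhere defined inverse of `I + A`. -/
def IsResolventOne (A : H →ₗ.[ℂ] H) (R : H →L[ℂ] H) : Prop :=
  ∀ f u : H, R f = u ↔ ∃ hu : u ∈ A.domain, u + A ⟨u, hu⟩ = f

open Classical in
/-- `(I + A)⁻¹`; it exists for every nonnegative self-adjoint `A`
(the value `0` is used if `I + A` has no bounded inverse). -/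
def resolventOne (A : H →ₗ.[ℂ] H) : H →L[ℂ] H :=
  if h : ∃ R : H →L[ℂ] H, IsResolventOne A R then h.choose else 0

/-- The function `x ↦ e^{-s (1/x - 1)}`: as `λ ↦ x = (1 + λ)⁻¹` maps `[0, ∞)` onto `(0, 1]`,
this is `e^{-s λ}` in terms of `x`.  At `x = 0` (that is, `λ = ∞`) it has its limit value. -/
def heatSymbol (s x : ℝ) : ℝ :=
  if s = 0 then 1 else if x ≤ 0 then 0 else Real.exp (-s * (x⁻¹ - 1))

/-- The heat semigroup `e^{-sA}`, `s ≥ 0`, of a nonnegative self-adjoint operator `A`, given by the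
spectral theorem: it is the function `x ↦ e^{-s (1/x - 1)}` of the bounded self-adjoint
operator `(I + A)⁻¹`. -/
def heatSemigroup (A : H →ₗ.[ℂ] H) (s : ℝ) : H →L[ℂ] H :=
  cfc (heatSymbol s) (resolventOne A)

theorem resolventOne_spec {A : H →ₗ.[ℂ] H} (h : ∃ R : H →L[ℂ] H, IsResolventOne A R) :
    IsResolventOne A (resolventOne A) := by
  unfold resolventOne
  rw [dif_pos h]
  exact h.choose_spec

/-- A nonnegative operator with `I + A` onto has a bounded inverse of `I + A`. -/
theorem exists_isResolventOne (A : H →ₗ.[ℂ] H)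
    (hpos : ∀ u : A.domain, 0 ≤ (inner ℂ (A u) (u : H)).re)
    (hsurj : ∀ f : H, ∃ u : A.domain, (u : H) + A u = f) :
    ∃ R : H →L[ℂ] H, IsResolventOne A R := by
  have hbd : ∀ u : A.domain, ‖(u : H)‖ ≤ ‖(u : H) + A u‖ := by
    intro u
    have h1 : (inner ℂ ((u : H) + A u) (u : H)).re ≤ ‖(u : H) + A u‖ * ‖(u : H)‖ :=
      re_inner_le_norm (𝕜 := ℂ) _ _
    have h3 : (inner ℂ (u : H) (u : H)).re = ‖(u : H)‖ ^ 2 := inner_self_eq_norm_sq (𝕜 := ℂ) _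
    rw [inner_add_left, Complex.add_re, h3] at h1
    have h2 := hpos u
    rcases (norm_nonneg (u : H)).eq_or_lt with h0 | h0
    · rw [← h0]; exact norm_nonneg _
    · nlinarith
  have huniq : ∀ u v : A.domain, (u : H) + A u = v + A v → u = v := by
    intro u v h
    have h1 := hbd (u - v)
    have h2 : ((u - v : A.domain) : H) + A (u - v) = 0 := by
      rw [A.map_sub, Submodule.coe_sub]
      have : (u : H) - v + (A u - A v) = ((u : H) + A u) - (v + A v) := by abel
      rw [this, h, sub_self]
    rw [h2, norm_zero] at h1
    have h3 : ((u - v : A.domain) : H) = 0 := norm_le_zero_iff.1 h1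
    exact sub_eq_zero.1 (Subtype.ext h3)
  choose r hr using hsurj
  let L : H →ₗ[ℂ] H :=
    { toFun := fun f => r f
      map_add' := fun f g => by
        have : r (f + g) = r f + r g := by
          refine huniq _ _ ?_
          rw [hr, A.map_add, Submodule.coe_add]
          conv_lhs => rw [← hr f, ← hr g]
          abel
        rw [this, Submodule.coe_add]
      map_smul' := fun c f => by
        have : r (c • f) = c • r f := by
          refine huniq _ _ ?_
          rw [hr, A.map_smul, Submodule.coe_smul, ← smul_add, hr]
        rw [this, Submodule.coe_smul, RingHom.id_apply] }
  refine ⟨L.mkContinuous 1 fun f => ?_, fun f u => ⟨?_, ?_⟩⟩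
  · have := hbd (r f)
    rw [hr] at this
    simpa [L] using this
  · rintro rfl
    exact ⟨(r f).2, hr f⟩
  · rintro ⟨hu, h⟩
    have : r f = ⟨u, hu⟩ := huniq _ _ (by rw [hr]; exact h.symm)
    change ((r f : A.domain) : H) = u
    rw [this]

/-- For a closed densely defined `T`, the space `H × K` is the orthogonal sum of the graph of `T`
and the rotated graph of `T*`. -/
theorem graph_decomposition (T : H →ₗ.[ℂ] K) (hd : Dense (T.domain : Set H)) (hc : T.IsClosed)
    (a : H) (b : K) : ∃ (u : T.domain) (v : T†.domain),
      a = u - T† v ∧ b = T u + v := by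
  let G : Submodule ℂ (WithLp 2 (H × K)) :=
    T.graph.comap (WithLp.linearEquiv 2 ℂ (H × K)).toLinearMap
  have hG : IsClosed (G : Set (WithLp 2 (H × K))) :=
    IsClosed.preimage (WithLp.prod_continuous_ofLp 2 H K) hc
  have : CompleteSpace G := hG.completeSpace_coe
  obtain ⟨y, hy, z, hz, hyz⟩ :=
    G.exists_add_mem_mem_orthogonal (WithLp.toLp 2 (a, b))
  have hy' : y.ofLp ∈ T.graph := hy
  rw [LinearPMap.mem_graph_iff] at hy'
  obtain ⟨u, hu1, hu2⟩ := hy'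
  have hz' : ∀ x : T.domain, inner ℂ (-z.fst) (x : H) = inner ℂ z.snd (T x) := by
    intro x
    have hx : WithLp.toLp 2 ((x : H), T x) ∈ G := T.mem_graph x
    have h := (Submodule.mem_orthogonal' G z).1 hz _ hx
    rw [WithLp.prod_inner_apply] at h
    rw [inner_neg_left]
    exact neg_eq_of_add_eq_zero_right h
  have hv : z.snd ∈ T†.domain := LinearPMap.mem_adjoint_domain_of_exists _ ⟨_, hz'⟩
  have hv2 : T† ⟨z.snd, hv⟩ = -z.fst := LinearPMap.adjoint_apply_eq hd _ hz'
  refine ⟨u, ⟨z.snd, hv⟩, ?_, ?_⟩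
  · rw [hv2, sub_neg_eq_add, hu1]
    exact congrArg (fun w : WithLp 2 (H × K) => w.fst) hyz
  · rw [hu2]
    exact congrArg (fun w : WithLp 2 (H × K) => w.snd) hyz

/-- `I + T* T` has a bounded everywhere defined inverse. -/
theorem exists_isResolventOne_adjoint_comp (T : H →ₗ.[ℂ] K) (hd : Dense (T.domain : Set H))
    (hc : T.IsClosed) : ∃ R : H →L[ℂ] H, IsResolventOne (-pcomp (-T†) T) R := by
  refine exists_isResolventOne _ (fun u => ?_) fun f => ?_
  · have h := LinearPMap.adjoint_isFormalAdjoint hd ⟨T ⟨u.1, u.2.fst⟩, u.2.snd⟩ ⟨u.1, u.2.fst⟩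
    have h' : (-pcomp (-T†) T) u = T† ⟨T ⟨u.1, u.2.fst⟩, u.2.snd⟩ := neg_neg _
    rw [h', h]
    exact inner_self_nonneg (𝕜 := ℂ)
  · obtain ⟨u, v, h1, h2⟩ := graph_decomposition T hd hc f 0
    have hv : T u = -v := eq_neg_of_add_eq_zero_left h2.symm
    have hm : T u ∈ (-T†).domain := by
      rw [hv]; exact T†.domain.neg_mem v.2
    refine ⟨⟨u, u.2, hm⟩, ?_⟩
    have h' : (-pcomp (-T†) T) ⟨u, u.2, hm⟩ = T† ⟨T u, hm⟩ := neg_neg _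
    rw [h', h1, sub_eq_add_neg, ← LinearPMap.map_neg]
    congr 2
    exact Subtype.ext hv

/-- `I + T T*` has a bounded everywhere defined inverse. -/
theorem exists_isResolventOne_comp_adjoint (T : H →ₗ.[ℂ] K) (hd : Dense (T.domain : Set H))
    (hc : T.IsClosed) : ∃ R : K →L[ℂ] K, IsResolventOne (-pcomp T (-T†)) R := by
  have happ : ∀ u : (-pcomp T (-T†)).domain, ∃ (h : (u : K) ∈ T†.domain)
      (h' : T† ⟨u, h⟩ ∈ T.domain), (-pcomp T (-T†)) u = T ⟨T† ⟨u, h⟩, h'⟩ := by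
    rintro ⟨u, h1, h2⟩
    have h3 : T† ⟨u, h1⟩ ∈ T.domain := by
      have := T.domain.neg_mem h2
      rwa [LinearPMap.neg_apply, neg_neg] at this
    refine ⟨h1, h3, ?_⟩
    change -T ⟨-T† ⟨u, h1⟩, h2⟩ = _
    rw [← LinearPMap.map_neg]
    exact congrArg T (Subtype.ext (neg_neg _))
  refine exists_isResolventOne _ (fun u => ?_) fun f => ?_
  · obtain ⟨h, h', he⟩ := happ u
    have hf := (LinearPMap.adjoint_isFormalAdjoint hd).symm ⟨T† ⟨u, h⟩, h'⟩ ⟨u, h⟩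
    rw [he, hf]
    exact inner_self_nonneg (𝕜 := ℂ)
  · obtain ⟨u, v, h1, h2⟩ := graph_decomposition T hd hc 0 f
    have hu : T† v = u := (sub_eq_zero.1 h1.symm).symm
    have hm : (v : K) ∈ (-pcomp T (-T†)).domain := by
      refine ⟨v.2, ?_⟩
      change -T† v ∈ T.domain
      rw [hu]; exact T.domain.neg_mem u.2
    refine ⟨⟨v, hm⟩, ?_⟩
    obtain ⟨h, h', he⟩ := happ ⟨v, hm⟩
    rw [he, h2, add_comm]
    congr 2
    exact Subtype.ext hu

end Heat

/-! ### The operators on `L²(ℂ)` -/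

/-- `L²(ℂ)` with respect to Lebesgue measure. -/
abbrev L2C : Type := Lp ℂ 2 (volume : Measure ℂ)

/-- The Wirtinger derivative `∂φ/∂z̄ = ½ (∂φ/∂x₁ + i ∂φ/∂x₂)`. -/
def dbar (φ : ℂ → ℂ) (z : ℂ) : ℂ :=
  (1 / 2) * (fderiv ℝ φ z 1 + Complex.I * fderiv ℝ φ z Complex.I)

/-- The real-valued function `p(z) = P(x₁, x₂)`, `z = x₁ + i x₂`, of a real polynomial `P`. -/
def polyFun (P : MvPolynomial (Fin 2) ℝ) (z : ℂ) : ℝ :=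
  MvPolynomial.eval ![z.re, z.im] P

/-- A real-valued function on `ℂ` is subharmonic if it is upper semicontinuous and satisfies the
sub-mean value inequality on every circle. -/
def IsSubharmonic (p : ℂ → ℝ) : Prop :=
  UpperSemicontinuous p ∧ ∀ c : ℂ, ∀ r : ℝ, 0 < r → p c ≤ Real.circleAverage p c r

/-- The formal transpose `-∂/∂z̄ + τ ∂p/∂z̄` of `∂/∂z̄ + τ ∂p/∂z̄`, applied to `φ`. -/
def ZbarTranspose (P : MvPolynomial (Fin 2) ℝ) (τ : ℝ) (φ : ℂ → ℂ) (z : ℂ) : ℂ :=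
  -dbar φ z + (τ : ℂ) * dbar (fun w => (polyFun P w : ℂ)) z * φ z

/-- `(∂/∂z̄ + τ ∂p/∂z̄) f = g` in the sense of distributions. -/
def WeakZbar (P : MvPolynomial (Fin 2) ℝ) (τ : ℝ) (f g : ℂ → ℂ) : Prop :=
  ∀ φ : ℂ → ℂ, ContDiff ℝ ∞ φ → HasCompactSupport φ →
    ∫ z, f z * ZbarTranspose P τ φ z = ∫ z, g z * φ z

theorem dbar_contDiff {φ : ℂ → ℂ} (h : ContDiff ℝ ∞ φ) : ContDiff ℝ ∞ (dbar φ) := by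
  unfold dbar
  have : ContDiff ℝ ∞ (fderiv ℝ φ) := h.fderiv_right (by simp)
  fun_prop

theorem dbar_hasCompactSupport {φ : ℂ → ℂ} (h : HasCompactSupport φ) :
    HasCompactSupport (dbar φ) := by
  refine (h.fderiv (𝕜 := ℝ)).mono fun z hz => ?_
  contrapose! hz
  rw [Function.notMem_support] at hz ⊢
  simp [dbar, hz]

theorem polyFun_contDiff (P : MvPolynomial (Fin 2) ℝ) :
    ContDiff ℝ ∞ (fun z => (polyFun P z : ℂ)) := by
  have h : ContDiff ℝ ∞ (polyFun P) := by
    unfold polyFun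
    induction P using MvPolynomial.induction_on with
    | C a =>
      simp only [MvPolynomial.eval_C]
      exact contDiff_const
    | add P Q h1 h2 =>
      simp only [map_add]
      exact h1.add h2
    | mul_X P i h1 =>
      have hi : ContDiff ℝ ∞ (fun z : ℂ => (![z.re, z.im] : Fin 2 → ℝ) i) := by
        fin_cases i
        · exact Complex.reCLM.contDiff
        · exact Complex.imCLM.contDiff
      simp only [map_mul, MvPolynomial.eval_X]
      exact h1.mul hi
  exact Complex.ofRealCLM.contDiff.comp h

theorem ZbarTranspose_contDiff (P : MvPolynomial (Fin 2) ℝ) (τ : ℝ) {φ : ℂ → ℂ}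
    (h : ContDiff ℝ ∞ φ) : ContDiff ℝ ∞ (ZbarTranspose P τ φ) := by
  have h1 := dbar_contDiff h
  have h2 := dbar_contDiff (polyFun_contDiff P)
  unfold ZbarTranspose
  fun_prop

theorem ZbarTranspose_hasCompactSupport (P : MvPolynomial (Fin 2) ℝ) (τ : ℝ) {φ : ℂ → ℂ}
    (h : HasCompactSupport φ) : HasCompactSupport (ZbarTranspose P τ φ) :=
  (dbar_hasCompactSupport h).neg.add h.mul_left

/-- Integration against a continuous compactly supported function is a continuous functional
on `L²(ℂ)`. -/
theorem exists_inner_eq_integral {ψ : ℂ → ℂ} (h : Continuous ψ) (hc : HasCompactSupport ψ) :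
    ∃ k : L2C, ∀ f : L2C, inner ℂ k f = ∫ z, f z * ψ z := by
  have hm : MemLp (fun z => (starRingEnd ℂ) (ψ z)) 2 (volume : Measure ℂ) :=
    (Complex.continuous_conj.comp h).memLp_of_hasCompactSupport
      (hc.comp_left (g := starRingEnd ℂ) (map_zero _))
  refine ⟨hm.toLp _, fun f => ?_⟩
  rw [L2.inner_def]
  refine integral_congr_ae ?_
  filter_upwards [hm.coeFn_toLp] with z hz
  rw [hz]
  simp

theorem weakZbar_iff (P : MvPolynomial (Fin 2) ℝ) (τ : ℝ) :
    ∃ k l : {φ : ℂ → ℂ // ContDiff ℝ ∞ φ ∧ HasCompactSupport φ} → L2C,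
      ∀ f g : L2C, WeakZbar P τ f g ↔ ∀ φ, inner ℂ (k φ) f = inner ℂ (l φ) g := by
  choose k hk using fun φ : {φ : ℂ → ℂ // ContDiff ℝ ∞ φ ∧ HasCompactSupport φ} =>
    exists_inner_eq_integral (ZbarTranspose_contDiff P τ φ.2.1).continuous
      (ZbarTranspose_hasCompactSupport P τ φ.2.2)
  choose l hl using fun φ : {φ : ℂ → ℂ // ContDiff ℝ ∞ φ ∧ HasCompactSupport φ} =>
    exists_inner_eq_integral φ.2.1.continuous φ.2.2
  refine ⟨k, l, fun f g => ⟨fun h φ => ?_, fun h φ h1 h2 => ?_⟩⟩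
  · rw [hk, hl]; exact h φ.1 φ.2.1 φ.2.2
  · have := h ⟨φ, h1, h2⟩
    rwa [hk, hl] at this

/-- The graph `{(f, g) ∈ L² × L² : (∂/∂z̄ + τ ∂p/∂z̄) f = g weakly}`. -/
def ZbarGraph (P : MvPolynomial (Fin 2) ℝ) (τ : ℝ) : Submodule ℂ (L2C × L2C) where
  carrier := {x | WeakZbar P τ x.1 x.2}
  zero_mem' := by
    obtain ⟨k, l, h⟩ := weakZbar_iff P τ
    refine (h _ _).2 fun φ => ?_
    simp
  add_mem' := by
    obtain ⟨k, l, h⟩ := weakZbar_iff P τ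
    intro x y hx hy
    refine (h _ _).2 fun φ => ?_
    have h1 := (h _ _).1 hx φ
    have h2 := (h _ _).1 hy φ
    simp only [Prod.fst_add, Prod.snd_add, inner_add_right, h1, h2]
  smul_mem' := by
    obtain ⟨k, l, h⟩ := weakZbar_iff P τ
    intro c x hx
    refine (h _ _).2 fun φ => ?_
    have h1 := (h _ _).1 hx φ
    simp only [Prod.smul_fst, Prod.smul_snd, inner_smul_right, h1]

/-- The closed operator `Z̄ = ∂/∂z̄ + τ ∂p/∂z̄` on `L²(ℂ)`, taken in the sense of distributions:
its domain consists of all `f ∈ L²(ℂ)` with `Z̄ f ∈ L²(ℂ)`. -/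
def Zbar (P : MvPolynomial (Fin 2) ℝ) (τ : ℝ) : L2C →ₗ.[ℂ] L2C :=
  (ZbarGraph P τ).toLinearPMap

/-- `Z = -Z̄*`, the negative of the Hilbert space adjoint of `Z̄`
(formally `∂/∂z - τ ∂p/∂z`). -/
def Zop (P : MvPolynomial (Fin 2) ℝ) (τ : ℝ) : L2C →ₗ.[ℂ] L2C :=
  -(Zbar P τ)†

/-- `□ = -Z̄ Z = Z̄ Z̄*`. -/
def Box (P : MvPolynomial (Fin 2) ℝ) (τ : ℝ) : L2C →ₗ.[ℂ] L2C :=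
  -pcomp (Zbar P τ) (Zop P τ)

/-- `□̃ = -Z Z̄ = Z̄* Z̄`. -/
def Boxw (P : MvPolynomial (Fin 2) ℝ) (τ : ℝ) : L2C →ₗ.[ℂ] L2C :=
  -pcomp (Zop P τ) (Zbar P τ)

/-! ### The operators are well defined -/

theorem ZbarGraph_single_valued (P : MvPolynomial (Fin 2) ℝ) (τ : ℝ) :
    ∀ x ∈ ZbarGraph P τ, x.1 = 0 → x.2 = 0 := by
  intro x hx h0
  have hx' : WeakZbar P τ x.1 x.2 := hx
  have hz : ((x.1 : L2C) : ℂ → ℂ) =ᵐ[volume] 0 := by rw [h0]; exact Lp.coeFn_zero _ _ _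
  refine (Lp.eq_zero_iff_ae_eq_zero).2 ?_
  refine ae_eq_zero_of_integral_contDiff_smul_eq_zero
    ((Lp.memLp x.2).locallyIntegrable (by norm_num)) fun g hg hgc => ?_
  have h := hx' (fun z => (g z : ℂ)) (Complex.ofRealCLM.contDiff.comp hg)
    (hgc.comp_left (g := fun r : ℝ => (r : ℂ)) Complex.ofReal_zero)
  have h1 : ∫ z, (x.1 : L2C) z * ZbarTranspose P τ (fun z => (g z : ℂ)) z = 0 := by
    refine integral_eq_zero_of_ae ?_
    filter_upwards [hz] with z hz
    simp [hz]
  rw [h1] at h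
  rw [h]
  refine integral_congr_ae (Filter.Eventually.of_forall fun z => ?_)
  simp [mul_comm]

theorem Zbar_graph (P : MvPolynomial (Fin 2) ℝ) (τ : ℝ) :
    (Zbar P τ).graph = ZbarGraph P τ :=
  Submodule.toLinearPMap_graph_eq _ fun x hx h0 => ZbarGraph_single_valued P τ x hx h0

theorem Zbar_isClosed (P : MvPolynomial (Fin 2) ℝ) (τ : ℝ) : (Zbar P τ).IsClosed := by
  unfold LinearPMap.IsClosed
  rw [Zbar_graph]
  obtain ⟨k, l, h⟩ := weakZbar_iff P τ
  have : (ZbarGraph P τ : Set (L2C × L2C)) =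
      ⋂ φ, {x : L2C × L2C | inner ℂ (k φ) x.1 = inner ℂ (l φ) x.2} := by
    ext x
    simp only [Set.mem_iInter]
    exact h x.1 x.2
  rw [this]
  exact isClosed_iInter fun φ => isClosed_eq (by fun_prop) (by fun_prop)

theorem weakZbar_of_contDiff (P : MvPolynomial (Fin 2) ℝ) (τ : ℝ) {ψ : ℂ → ℂ}
    (h : ContDiff ℝ ∞ ψ) (hc : HasCompactSupport ψ) :
    WeakZbar P τ ψ
      (fun z => dbar ψ z + (τ : ℂ) * dbar (fun w => (polyFun P w : ℂ)) z * ψ z) := by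
  intro φ hφ hφc
  have hq := (dbar_contDiff (polyFun_contDiff P)).continuous
  have hdψ := (dbar_contDiff h).continuous
  have hdφ := (dbar_contDiff hφ).continuous
  have hψ0 := h.continuous
  have hφ0 := hφ.continuous
  have h1 : Continuous (fderiv ℝ ψ) := h.continuous_fderiv (by simp)
  have h2 : Continuous (fderiv ℝ φ) := hφ.continuous_fderiv (by simp)
  have key : ∀ v : ℂ, ∫ z, ψ z * fderiv ℝ φ z v = -∫ z, fderiv ℝ ψ z v * φ z := fun v =>
    integral_mul_fderiv_eq_neg_fderiv_mul_of_integrable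
      ((by fun_prop : Continuous fun z => fderiv ℝ ψ z v * φ z).integrable_of_hasCompactSupport
        hφc.mul_left)
      ((by fun_prop : Continuous fun z => ψ z * fderiv ℝ φ z v).integrable_of_hasCompactSupport
        hc.mul_right)
      ((by fun_prop : Continuous fun z => ψ z * φ z).integrable_of_hasCompactSupport
        hc.mul_right)
      (fun x _ => h.differentiable (by simp) x) (fun x _ => hφ.differentiable (by simp) x)
  have i1 : ∀ v : ℂ, Integrable fun z => ψ z * fderiv ℝ φ z v := fun v =>
    (by fun_prop : Continuous fun z => ψ z * fderiv ℝ φ z v).integrable_of_hasCompactSupport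
      hc.mul_right
  have i2 : ∀ v : ℂ, Integrable fun z => fderiv ℝ ψ z v * φ z := fun v =>
    (by fun_prop : Continuous fun z => fderiv ℝ ψ z v * φ z).integrable_of_hasCompactSupport
      hφc.mul_left
  have i3 : Integrable fun z =>
      (τ : ℂ) * dbar (fun w => (polyFun P w : ℂ)) z * ψ z * φ z :=
    (by fun_prop : Continuous fun z =>
      (τ : ℂ) * dbar (fun w => (polyFun P w : ℂ)) z * ψ z * φ z).integrable_of_hasCompactSupport
      hφc.mul_left
  have e1 : ∀ z, ψ z * ZbarTranspose P τ φ z =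
      (-(1 / 2)) * (ψ z * fderiv ℝ φ z 1) + (-(Complex.I / 2)) * (ψ z * fderiv ℝ φ z Complex.I) +
        (τ : ℂ) * dbar (fun w => (polyFun P w : ℂ)) z * ψ z * φ z := by
    intro z
    simp only [ZbarTranspose, dbar]
    ring
  have e2 : ∀ z, (dbar ψ z + (τ : ℂ) * dbar (fun w => (polyFun P w : ℂ)) z * ψ z) * φ z =
      (1 / 2) * (fderiv ℝ ψ z 1 * φ z) + (Complex.I / 2) * (fderiv ℝ ψ z Complex.I * φ z) +
        (τ : ℂ) * dbar (fun w => (polyFun P w : ℂ)) z * ψ z * φ z := by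
    intro z
    simp only [dbar]
    ring
  simp only [e1, e2]
  have a1 := (i1 1).const_mul (-(1 / 2))
  have a2 := (i1 Complex.I).const_mul (-(Complex.I / 2))
  have b1 := (i2 1).const_mul (1 / 2)
  have b2 := (i2 Complex.I).const_mul (Complex.I / 2)
  rw [integral_add (by exact a1.add a2) i3, integral_add (by exact b1.add b2) i3,
    integral_add a1 a2, integral_add b1 b2]
  simp only [integral_const_mul, key]
  ring

theorem Zbar_dense (P : MvPolynomial (Fin 2) ℝ) (τ : ℝ) :
    Dense ((Zbar P τ).domain : Set L2C) := by
  refine (Lp.dense_hasCompactSupport_contDiff (F := ℂ) (μ := (volume : Measure ℂ)) (p := 2)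
    (by norm_num)).mono ?_
  rintro f ⟨ψ, hf, hc, hψ⟩
  have hc2 : HasCompactSupport
      (fun z => dbar ψ z + (τ : ℂ) * dbar (fun w => (polyFun P w : ℂ)) z * ψ z) :=
    (dbar_hasCompactSupport hc).add hc.mul_left
  have hcont : Continuous
      (fun z => dbar ψ z + (τ : ℂ) * dbar (fun w => (polyFun P w : ℂ)) z * ψ z) := by
    have h1 := (dbar_contDiff hψ).continuous
    have h2 := (dbar_contDiff (polyFun_contDiff P)).continuous
    have h3 := hψ.continuous
    fun_prop
  have hm : MemLp (fun z => dbar ψ z + (τ : ℂ) * dbar (fun w => (polyFun P w : ℂ)) z * ψ z) 2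
      (volume : Measure ℂ) := hcont.memLp_of_hasCompactSupport hc2
  refine Submodule.mem_map.2 ⟨(f, hm.toLp _), ?_, rfl⟩
  intro φ hφ hφc
  have h := weakZbar_of_contDiff P τ hψ hc φ hφ hφc
  refine Eq.trans (integral_congr_ae ?_) (h.trans (integral_congr_ae ?_))
  · filter_upwards [hf] with z hz
    rw [hz]
  · filter_upwards [hm.coeFn_toLp] with z hz
    rw [hz]

/-- `(I + □)⁻¹` exists as a bounded operator. -/
theorem isResolventOne_Box (P : MvPolynomial (Fin 2) ℝ) (τ : ℝ) :
    IsResolventOne (Box P τ) (resolventOne (Box P τ)) :=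
  resolventOne_spec
    (exists_isResolventOne_comp_adjoint _ (Zbar_dense P τ) (Zbar_isClosed P τ))

/-- `(I + □̃)⁻¹` exists as a bounded operator. -/
theorem isResolventOne_Boxw (P : MvPolynomial (Fin 2) ℝ) (τ : ℝ) :
    IsResolventOne (Boxw P τ) (resolventOne (Boxw P τ)) :=
  resolventOne_spec
    (exists_isResolventOne_adjoint_comp _ (Zbar_dense P τ) (Zbar_isClosed P τ))

end

/-! The argument is abstract: `T` is closed and densely defined, `-S` and `T` are formally adjoint,
and `A = (I - S T)⁻¹` and `B = (I - T S)⁻¹` are bounded and everywhere defined. Algebra gives `B T ⊆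
T A`, that is, the graph of `T` is invariant under `A × B` (`graph_invariant_resolvent`). The graph
is a closed linear subspace, so invariance passes to polynomials in the pair and, by Weierstrass
approximation, to `φ(A) × φ(B)` for every continuous `φ` (`prod_mem_of_cfc`). In the variable `x =
(1 + λ)⁻¹` the function `e^{-sλ}` is continuous, also at `x = 0` when `s > 0`; this yields the
inclusion of operators.

For `s > 0` the symbol is `x` times a continuous function, so the heat semigroup of `-S T` maps into
the range of `A`, which lies in `Dom (S T) ⊆ Dom T`. Hence `T e^{sST}` is closed and everywhere
defined, so bounded by the closed graph theorem, and it is the closure of its restriction to the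
dense subspace `Dom T`. For `s = 0` both compositions are `T`. The two halves of the theorem are
this statement for `T = Z̄, S = Z` and for `T = Z, S = Z̄`. -/

/-! ### Functional calculus on invariant graphs -/

section Intertwining

set_option linter.unusedSectionVars false

variable {H K : Type*} [NormedAddCommGroup H] [InnerProductSpace ℂ H] [CompleteSpace H]
  [NormedAddCommGroup K] [InnerProductSpace ℂ K] [CompleteSpace K]

/-- A subspace of `H × K` invariant under `A × B` is invariant under `q(A) × q(B)` for every real
polynomial `q`. -/
theorem prod_mem_of_aeval (G : Submodule ℂ (H × K)) {A : H →L[ℂ] H} {B : K →L[ℂ] K}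
    (hG : ∀ x ∈ G, (A x.1, B x.2) ∈ G) (q : Polynomial ℝ) :
    ∀ x ∈ G, (Polynomial.aeval A q x.1, Polynomial.aeval B q x.2) ∈ G := by
  induction q using Polynomial.induction_on with
  | C r =>
    intro x hx
    simpa [Algebra.algebraMap_eq_smul_one, Prod.smul_def] using G.smul_mem (r : ℂ) hx
  | add p q hp hq =>
    intro x hx
    simpa using G.add_mem (hp x hx) (hq x hx)
  | monomial n r h =>
    intro x hx
    simpa [pow_succ] using h _ (hG x hx)

theorem abs_le_norm_of_mem_spectrum (A : H →L[ℂ] H) {x : ℝ} (hx : x ∈ spectrum ℝ A) :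
    |x| ≤ ‖A‖ :=
  (spectrum.norm_le_norm_mul_of_mem hx).trans
    -- Only `‖1‖ ≤ 1` is used, since `‖1‖ = 0` when `H` is trivial.
    (mul_le_of_le_one_right (norm_nonneg _) ContinuousLinearMap.norm_id_le)

/-- The functional calculus of a self-adjoint operator is bounded by the sup norm on the spectrum,
which lies in `[-M, M]`. Leaving `M` free lets the same polynomial serve two operators. -/
theorem norm_aeval_sub_cfc_le {A : H →L[ℂ] H} (hA : IsSelfAdjoint A) {φ : ℝ → ℝ}
    (hφ : Continuous φ) {M ε : ℝ} (hM : ‖A‖ ≤ M) (hε : 0 ≤ ε) {q : Polynomial ℝ}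
    (hq : ∀ x ∈ Set.Icc (-M) M, |q.eval x - φ x| < ε) :
    ‖Polynomial.aeval A q - cfc φ A‖ ≤ ε := by
  rw [← cfc_polynomial q A hA, ← cfc_sub _ _ A q.continuous.continuousOn hφ.continuousOn]
  exact norm_cfc_le hε fun x hx =>
    (hq x (abs_le.1 ((abs_le_norm_of_mem_spectrum A hx).trans hM))).le

/-- A closed subspace of `H × K` invariant under `A × B`, with `A` and `B` self-adjoint, is
invariant under `φ(A) × φ(B)` for every continuous `φ`. -/
theorem prod_mem_of_cfc (G : Submodule ℂ (H × K)) (hGc : IsClosed (G : Set (H × K)))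
    {A : H →L[ℂ] H} {B : K →L[ℂ] K} (hA : IsSelfAdjoint A) (hB : IsSelfAdjoint B)
    (hG : ∀ x ∈ G, (A x.1, B x.2) ∈ G) {φ : ℝ → ℝ} (hφ : Continuous φ) :
    ∀ x ∈ G, (cfc φ A x.1, cfc φ B x.2) ∈ G := by
  intro x hx
  have hpos : ∀ n : ℕ, (0 : ℝ) < 1 / ((n : ℝ) + 1) := fun n => Nat.one_div_pos_of_nat
  -- The interval contains both spectra, so one sequence of polynomials approximates `φ` at `A` and
  -- at `B`.
  choose q hq using fun n : ℕ => exists_polynomial_near_of_continuousOn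
    (-max ‖A‖ ‖B‖) (max ‖A‖ ‖B‖) φ hφ.continuousOn _ (hpos n)
  have hlimA : Filter.Tendsto (fun n => Polynomial.aeval A (q n)) Filter.atTop
      (nhds (cfc φ A)) :=
    tendsto_iff_norm_sub_tendsto_zero.2 <| squeeze_zero (fun _ => norm_nonneg _)
      (fun n => norm_aeval_sub_cfc_le hA hφ (le_max_left _ _) (hpos n).le (hq n))
      tendsto_one_div_add_atTop_nhds_zero_nat
  have hlimB : Filter.Tendsto (fun n => Polynomial.aeval B (q n)) Filter.atTop
      (nhds (cfc φ B)) :=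
    tendsto_iff_norm_sub_tendsto_zero.2 <| squeeze_zero (fun _ => norm_nonneg _)
      (fun n => norm_aeval_sub_cfc_le hB hφ (le_max_right _ _) (hpos n).le (hq n))
      tendsto_one_div_add_atTop_nhds_zero_nat
  refine hGc.mem_of_tendsto (Filter.Tendsto.prodMk_nhds
    (((ContinuousLinearMap.apply ℂ H x.1).continuous.tendsto _).comp hlimA)
    (((ContinuousLinearMap.apply ℂ K x.2).continuous.tendsto _).comp hlimB))
    (Filter.Eventually.of_forall fun n => prod_mem_of_aeval G hG (q n) x hx)

end Intertwining

/-! ### Continuity of the heat symbol -/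

section Symbol

/-- With `y = x⁻¹ → ∞` the function is `s⁻¹ e^s · (s y) e^{-s y}`. -/
theorem tendsto_inv_mul_exp_nhdsGT (s : ℝ) (hs : 0 < s) :
    Filter.Tendsto (fun x : ℝ => x⁻¹ * Real.exp (-s * (x⁻¹ - 1))) (nhdsWithin 0 (Set.Ioi 0))
      (nhds 0) := by
  have h := (Real.tendsto_pow_mul_exp_neg_atTop_nhds_zero 1).comp
    ((Filter.tendsto_const_mul_atTop_of_pos hs).2 (tendsto_inv_nhdsGT_zero (𝕜 := ℝ)))
  have h2 := h.const_mul (s⁻¹ * Real.exp s)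
  rw [mul_zero] at h2
  refine h2.congr fun x => ?_
  have : Real.exp (-s * (x⁻¹ - 1)) = Real.exp s * Real.exp (-(s * x⁻¹)) := by
    rw [← Real.exp_add]; ring_nf
  simp only [Function.comp, this, pow_one]
  field_simp

/-- The function `heatSymbol s x / x`, which is continuous for `s > 0`. -/
noncomputable def heatSymbolDiv (s x : ℝ) : ℝ :=
  if x ≤ 0 then 0 else x⁻¹ * Real.exp (-s * (x⁻¹ - 1))

theorem continuous_heatSymbolDiv {s : ℝ} (hs : 0 < s) : Continuous (heatSymbolDiv s) := by
  rw [continuous_iff_continuousAt]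
  intro x
  rcases lt_trichotomy x 0 with hx | rfl | hx
  · refine (continuousAt_const (y := (0 : ℝ))).congr ?_
    filter_upwards [gt_mem_nhds hx] with y hy
    exact (if_pos hy.le).symm
  · rw [continuousAt_iff_continuous_left'_right']
    have h0 : heatSymbolDiv s 0 = 0 := if_pos le_rfl
    refine ⟨?_, ?_⟩ <;> rw [ContinuousWithinAt, h0]
    · refine tendsto_const_nhds.congr' ?_
      filter_upwards [self_mem_nhdsWithin] with y hy
      exact (if_pos (le_of_lt hy)).symm
    · refine (tendsto_inv_mul_exp_nhdsGT s hs).congr' ?_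
      filter_upwards [self_mem_nhdsWithin] with y hy
      exact (if_neg (not_le.2 hy)).symm
  · have hc : ContinuousAt (fun x : ℝ => x⁻¹ * Real.exp (-s * (x⁻¹ - 1))) x := by
      fun_prop (disch := exact hx.ne')
    refine hc.congr ?_
    filter_upwards [lt_mem_nhds hx] with y hy
    exact (if_neg (not_le.2 hy)).symm

/-- Under the functional calculus the factor `x` becomes the resolvent; this is the smoothing
effect. It fails for `s = 0`, where the symbol is `1` at `x = 0`. -/
theorem heatSymbol_eq_mul {s : ℝ} (hs : 0 < s) :
    heatSymbol s = fun x => x * heatSymbolDiv s x := by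
  funext x
  unfold heatSymbol heatSymbolDiv
  rw [if_neg hs.ne']
  split_ifs with h
  · rw [mul_zero]
  · rw [mul_inv_cancel_left₀ (not_le.1 h).ne']

theorem continuous_heatSymbol {s : ℝ} (hs : 0 ≤ s) : Continuous (heatSymbol s) := by
  rcases hs.eq_or_lt with rfl | hs
  · have : heatSymbol 0 = fun _ => 1 := funext fun x => if_pos rfl
    rw [this]
    exact continuous_const
  · rw [heatSymbol_eq_mul hs]
    exact continuous_id.mul (continuous_heatSymbolDiv hs)

end Symbol

/-! ### Graphs and closures of compositions -/

section HeatIntertwining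

set_option linter.unusedSectionVars false

variable {H K : Type*} [NormedAddCommGroup H] [InnerProductSpace ℂ H] [CompleteSpace H]
  [NormedAddCommGroup K] [InnerProductSpace ℂ K] [CompleteSpace K]

theorem mem_graph_pcomp_iff {E F G : Type*} [AddCommGroup E] [Module ℂ E] [AddCommGroup F]
    [Module ℂ F] [AddCommGroup G] [Module ℂ G] (g : F →ₗ.[ℂ] G) (f : E →ₗ.[ℂ] F) (x : E × G) :
    x ∈ (pcomp g f).graph ↔ ∃ y, (x.1, y) ∈ f.graph ∧ (y, x.2) ∈ g.graph := by
  constructor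
  · intro h
    obtain ⟨u, h1, h2⟩ := (LinearPMap.mem_graph_iff _).1 h
    refine ⟨f ⟨u, u.2.fst⟩, ?_, ?_⟩
    · rw [← h1]; exact f.mem_graph ⟨u, u.2.fst⟩
    · rw [← h2]; exact g.mem_graph ⟨_, u.2.snd⟩
  · rintro ⟨y, h1, h2⟩
    obtain ⟨u, hu1, hu2⟩ := (LinearPMap.mem_graph_iff _).1 h1
    obtain ⟨v, hv1, hv2⟩ := (LinearPMap.mem_graph_iff _).1 h2
    have hm : f ⟨u, u.2⟩ ∈ g.domain := by
      have : f ⟨u, u.2⟩ = v := hu2.trans hv1.symm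
      rw [this]; exact v.2
    refine (LinearPMap.mem_graph_iff _).2 ⟨⟨u, u.2, hm⟩, hu1, ?_⟩
    rw [← hv2]
    exact congrArg g (Subtype.ext (hu2.trans hv1.symm))

theorem mem_graph_toPMap_top_iff (S : H →L[ℂ] K) (x : H × K) :
    x ∈ ((S : H →ₗ[ℂ] K).toPMap ⊤).graph ↔ S x.1 = x.2 := by
  rw [LinearPMap.mem_graph_iff]
  exact ⟨fun ⟨u, h1, h2⟩ => by rw [← h1, ← h2]; rfl, fun h => ⟨⟨x.1, trivial⟩, rfl, h⟩⟩

/-- Composing with a bounded operator on the right makes the graph a preimage of `T.graph` under a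
continuous map, hence closed if `T` is. -/
theorem mem_graph_pcomp_toPMap_iff (T : H →ₗ.[ℂ] K) (S : H →L[ℂ] H) (x : H × K) :
    x ∈ (pcomp T ((S : H →ₗ[ℂ] H).toPMap ⊤)).graph ↔ (S x.1, x.2) ∈ T.graph := by
  simp only [mem_graph_pcomp_iff, mem_graph_toPMap_top_iff, exists_eq_left']

theorem mem_graph_toPMap_pcomp_iff (T : H →ₗ.[ℂ] K) (S : K →L[ℂ] K) (x : H × K) :
    x ∈ (pcomp ((S : K →ₗ[ℂ] K).toPMap ⊤) T).graph ↔
      ∃ y, (x.1, y) ∈ T.graph ∧ S y = x.2 := by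
  simp only [mem_graph_pcomp_iff, mem_graph_toPMap_top_iff]

theorem isClosed_pcomp_toPMap {T : H →ₗ.[ℂ] K} (hT : T.IsClosed) (S : H →L[ℂ] H) :
    (pcomp T ((S : H →ₗ[ℂ] H).toPMap ⊤)).IsClosed := by
  have : ((pcomp T ((S : H →ₗ[ℂ] H).toPMap ⊤)).graph : Set (H × K)) =
      (fun x : H × K => (S x.1, x.2)) ⁻¹' (T.graph : Set (H × K)) :=
    Set.ext fun x => mem_graph_pcomp_toPMap_iff T S x
  unfold LinearPMap.IsClosed
  rw [this]
  exact IsClosed.preimage (by fun_prop) hT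

/-- An everywhere defined closed operator is the closure of its restriction to a dense subspace. -/
theorem closure_eq_of_le_of_domain_eq_top {f g : H →ₗ.[ℂ] K} (hfg : f ≤ g) (hg : g.IsClosed)
    (hf : Dense (f.domain : Set H)) (hd : g.domain = ⊤) : f.closure = g := by
  have hfc : f.IsClosable := hg.isClosable.leIsClosable hfg
  refine LinearPMap.eq_of_eq_graph ?_
  rw [← hfc.graph_closure_eq_closure_graph]
  refine le_antisymm (Submodule.topologicalClosure_minimal _
    (LinearPMap.le_graph_of_le hfg) hg) ?_
  let L : H →ₗ[ℂ] K := g.toFun.comp (LinearMap.codRestrict g.domain LinearMap.id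
    fun x => by rw [hd]; trivial)
  have hL : ∀ x, (x, L x) ∈ g.graph := fun x => g.mem_graph ⟨x, by rw [hd]; trivial⟩
  have hgL : g.graph = L.graph := by
    ext x
    rw [LinearMap.mem_graph_iff]
    refine ⟨fun hx => LinearPMap.mem_graph_snd_inj _ hx (hL x.1) rfl, fun hx => ?_⟩
    have := hL x.1
    rwa [← hx] at this
  -- By the closed graph theorem `L` is continuous, so each `(x, L x)` is a limit of points `(y, L
  -- y)` with `y ∈ Dom f`.
  have hcont : Continuous L := by
    refine L.continuous_of_isClosed_graph ?_
    rw [← hgL]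
    exact hg
  rw [hgL]
  intro x hx
  rw [LinearMap.mem_graph_iff] at hx
  have hmaps : Set.MapsTo (fun y => (y, L y)) (f.domain : Set H) (f.graph : Set (H × K)) := by
    intro y hy
    have h1 : f ⟨y, hy⟩ = L y := hfg.2 (x := ⟨y, hy⟩) (y := ⟨y, by rw [hd]; trivial⟩) rfl
    change (y, L y) ∈ f.graph
    rw [← h1]
    exact f.mem_graph ⟨y, hy⟩
  have := map_mem_closure (continuous_id.prodMk hcont) (hf x.1) hmaps
  have hx' : x = (x.1, L x.1) := Prod.ext rfl hx
  rw [hx']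
  exact this

/-! ### Resolvents and the abstract intertwining -/

theorem IsResolventOne.mem_domain {A : H →ₗ.[ℂ] H} {R : H →L[ℂ] H} (hR : IsResolventOne A R)
    (f : H) : R f ∈ A.domain :=
  ((hR f (R f)).1 rfl).fst

/-- Write `f = (I + A) R f` and `g = (I + A) R g`; symmetry of `A` is enough because `R` is
everywhere defined. Without self-adjointness of `R`, `cfc` would take its default value `0`. -/
theorem IsResolventOne.isSelfAdjoint {A : H →ₗ.[ℂ] H} {R : H →L[ℂ] H} (hR : IsResolventOne A R)
    (hA : A.IsFormalAdjoint A) : IsSelfAdjoint R := by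
  rw [ContinuousLinearMap.isSelfAdjoint_iff_isSymmetric]
  intro f g
  obtain ⟨hu, hf⟩ := (hR f (R f)).1 rfl
  obtain ⟨hv, hg⟩ := (hR g (R g)).1 rfl
  have h := hA ⟨R f, hu⟩ ⟨R g, hv⟩
  change inner ℂ (R f) g = inner ℂ f (R g)
  conv_lhs => rw [← hg]
  conv_rhs => rw [← hf]
  rw [inner_add_left, inner_add_right, h]

/-- Both sides equal `⟨T x, T y⟩`. -/
theorem isFormalAdjoint_neg_pcomp {T : H →ₗ.[ℂ] K} {S : K →ₗ.[ℂ] H}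
    (h : (-S).IsFormalAdjoint T) : (-pcomp S T).IsFormalAdjoint (-pcomp S T) := by
  have key : ∀ (x : T.domain) (y : S.domain),
      inner ℂ (-S y) (x : H) = inner ℂ (y : K) (T x) := fun x y => h y x
  intro x y
  have h1 := key ⟨y, y.2.fst⟩ ⟨_, x.2.snd⟩
  have h2 := key ⟨x, x.2.fst⟩ ⟨_, y.2.snd⟩
  refine h1.trans ?_
  have h3 := congrArg (starRingEnd ℂ) h2
  rw [inner_conj_symm, inner_conj_symm] at h3
  exact h3.symm

/-- The graph of `T` is invariant under `(I - S T)⁻¹ × (I - T S)⁻¹`. -/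
theorem graph_invariant_resolvent {T : H →ₗ.[ℂ] K} {S : K →ₗ.[ℂ] H} {A : H →L[ℂ] H}
    {B : K →L[ℂ] K} (hA : IsResolventOne (-pcomp S T) A) (hB : IsResolventOne (-pcomp T S) B) :
    ∀ x ∈ T.graph, (A x.1, B x.2) ∈ T.graph := by
  intro x hx
  obtain ⟨f, h1, h2⟩ := (LinearPMap.mem_graph_iff _).1 hx
  obtain ⟨hu, he⟩ := (hA x.1 (A x.1)).1 rfl
  obtain ⟨hu1, hu2⟩ := id hu
  have he' : (f : H) = A x.1 - S ⟨T ⟨A x.1, hu1⟩, hu2⟩ := by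
    rw [h1, sub_eq_add_neg]; exact he.symm
  -- With `u = A f`, the vector `S T u = u - f` lies in `Dom T` because `u` and `f` do. Applying `T`
  -- gives `(I - T S) T u = T f`, so `B T f = T u`.
  have hS : S ⟨T ⟨A x.1, hu1⟩, hu2⟩ = ((⟨A x.1, hu1⟩ - f : T.domain) : H) := by
    rw [Submodule.coe_sub, he']; abel
  have hm : T ⟨A x.1, hu1⟩ ∈ (-pcomp T S).domain := ⟨hu2, by rw [hS]; exact Subtype.property _⟩
  have hB' : B x.2 = T ⟨A x.1, hu1⟩ := by
    refine (hB _ _).2 ⟨hm, ?_⟩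
    have h3 : (-pcomp T S) ⟨_, hm⟩ = -T (⟨A x.1, hu1⟩ - f) :=
      congrArg (fun z => -T z) (Subtype.ext hS)
    rw [h3, T.map_sub, h2]
    abel
  rw [hB']
  exact T.mem_graph ⟨A x.1, hu1⟩

theorem heatSemigroup_mem_domain {A : H →ₗ.[ℂ] H} (hA : IsResolventOne A (resolventOne A))
    (hAs : A.IsFormalAdjoint A) {s : ℝ} (hs : 0 < s) (f : H) :
    heatSemigroup A s f ∈ A.domain := by
  have hsa : IsSelfAdjoint (resolventOne A) := hA.isSelfAdjoint hAs
  unfold heatSemigroup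
  rw [heatSymbol_eq_mul hs, cfc_mul (fun x => x) _ _ continuousOn_id
    (continuous_heatSymbolDiv hs).continuousOn, cfc_id' ℝ _ hsa]
  exact hA.mem_domain _

theorem heatSemigroup_zero {A : H →ₗ.[ℂ] H} (hA : IsResolventOne A (resolventOne A))
    (hAs : A.IsFormalAdjoint A) : heatSemigroup A 0 = 1 := by
  have h : heatSymbol 0 = fun _ => 1 := funext fun x => if_pos rfl
  rw [heatSemigroup, h, cfc_const_one ℝ _ (hA.isSelfAdjoint hAs)]

/-- Intertwining of the heat semigroups of `-S T` and `-T S`. -/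
theorem heatSemigroup_intertwining {T : H →ₗ.[ℂ] K} {S : K →ₗ.[ℂ] H} (hT : T.IsClosed)
    (hd : Dense (T.domain : Set H)) (hST : (-S).IsFormalAdjoint T)
    (hTS : (-T).IsFormalAdjoint S)
    (hA : IsResolventOne (-pcomp S T) (resolventOne (-pcomp S T)))
    (hB : IsResolventOne (-pcomp T S) (resolventOne (-pcomp T S))) {s : ℝ} (hs : 0 ≤ s) :
    pcomp ((heatSemigroup (-pcomp T S) s).toPMap ⊤) T ≤
        pcomp T ((heatSemigroup (-pcomp S T) s).toPMap ⊤) ∧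
      (pcomp ((heatSemigroup (-pcomp T S) s).toPMap ⊤) T).closure =
        pcomp T ((heatSemigroup (-pcomp S T) s).toPMap ⊤) ∧
      (0 < s → (pcomp T ((heatSemigroup (-pcomp S T) s).toPMap ⊤)).domain = ⊤) := by
  have hsA := isFormalAdjoint_neg_pcomp hST
  have hsB := isFormalAdjoint_neg_pcomp hTS
  have hle : pcomp ((heatSemigroup (-pcomp T S) s).toPMap ⊤) T ≤
      pcomp T ((heatSemigroup (-pcomp S T) s).toPMap ⊤) := by
    refine LinearPMap.le_of_le_graph fun x hx => ?_
    obtain ⟨y, hy1, hy2⟩ := (mem_graph_toPMap_pcomp_iff _ _ _).1 hx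
    refine (mem_graph_pcomp_toPMap_iff _ _ _).2 ?_
    rw [← hy2]
    exact prod_mem_of_cfc T.graph hT (hA.isSelfAdjoint hsA) (hB.isSelfAdjoint hsB)
      (graph_invariant_resolvent hA hB) (continuous_heatSymbol hs) _ hy1
  have hcl := isClosed_pcomp_toPMap hT (heatSemigroup (-pcomp S T) s)
  have htop : 0 < s → (pcomp T ((heatSemigroup (-pcomp S T) s).toPMap ⊤)).domain = ⊤ :=
    fun hs' => eq_top_iff.2 fun f _ => ⟨trivial, (heatSemigroup_mem_domain hA hsA hs' f).fst⟩
  refine ⟨hle, ?_, htop⟩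
  -- At `s = 0` the right-hand side need not be everywhere defined, but both semigroups are the
  -- identity.
  rcases hs.eq_or_lt with rfl | hs'
  · have heq : pcomp ((heatSemigroup (-pcomp T S) 0).toPMap ⊤) T =
        pcomp T ((heatSemigroup (-pcomp S T) 0).toPMap ⊤) := by
      refine LinearPMap.eq_of_eq_graph (Submodule.ext fun x => ?_)
      rw [mem_graph_toPMap_pcomp_iff, mem_graph_pcomp_toPMap_iff, heatSemigroup_zero hA hsA,
        heatSemigroup_zero hB hsB]
      simp
    rw [heq]
    refine LinearPMap.eq_of_eq_graph ?_
    rw [← hcl.isClosable.graph_closure_eq_closure_graph]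
    exact hcl.submodule_topologicalClosure_eq
  · exact closure_eq_of_le_of_domain_eq_top hle hcl
      (hd.mono fun f hf => ⟨hf, trivial⟩) (htop hs')

/-- The adjoint of a closed densely defined operator is densely defined. -/
theorem dense_adjoint_domain {T : H →ₗ.[ℂ] K} (hd : Dense (T.domain : Set H))
    (hT : T.IsClosed) : Dense (T†.domain : Set K) := by
  rw [Submodule.dense_iff_topologicalClosure_eq_top,
    Submodule.topologicalClosure_eq_top_iff, Submodule.eq_bot_iff]
  intro b hb
  -- Decomposing `(0, b)` gives `u = T* v` and `b = T u + v`, so `⟨v, b⟩ = ‖u‖² + ‖v‖²`. This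
  -- vanishes when `b ⊥ Dom T*`.
  obtain ⟨u, v, h1, h2⟩ := graph_decomposition T hd hT 0 b
  have hu : (u : H) = T† v := sub_eq_zero.1 h1.symm
  have hv := (Submodule.mem_orthogonal _ _).1 hb v v.2
  have h3 := LinearPMap.adjoint_isFormalAdjoint hd v u
  rw [h2, inner_add_right, ← h3, ← hu, inner_self_eq_norm_sq_to_K,
    inner_self_eq_norm_sq_to_K] at hv
  have h4 : ‖(u : H)‖ ^ 2 + ‖(v : K)‖ ^ 2 = 0 := Complex.ofReal_injective (by simpa using hv)
  have hv0 : (v : K) = 0 := by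
    rw [← norm_eq_zero, ← sq_eq_zero_iff]; nlinarith [sq_nonneg ‖(u : H)‖, sq_nonneg ‖(v : K)‖]
  have hu0 : u = 0 := by
    refine Subtype.ext ?_
    rw [Submodule.coe_zero, ← norm_eq_zero, ← sq_eq_zero_iff]
    nlinarith [sq_nonneg ‖(u : H)‖, sq_nonneg ‖(v : K)‖]
  rw [h2, hu0, hv0, T.map_zero, add_zero]

theorem LinearPMap.IsClosed.neg {T : H →ₗ.[ℂ] K} (hT : T.IsClosed) : (-T).IsClosed := by
  have : ((-T).graph : Set (H × K)) =
      (fun x : H × K => (x.1, -x.2)) ⁻¹' (T.graph : Set (H × K)) := by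
    ext x
    simp only [SetLike.mem_coe, Set.mem_preimage, LinearPMap.mem_graph_iff, LinearPMap.neg_apply]
    exact exists_congr fun u => and_congr_right fun _ => neg_eq_iff_eq_neg
  unfold LinearPMap.IsClosed
  rw [this]
  exact IsClosed.preimage (by fun_prop) hT

end HeatIntertwining

/-! ### Application to `Z̄` and `Z` -/

theorem Zop_isClosed (P : MvPolynomial (Fin 2) ℝ) (τ : ℝ) : (Zop P τ).IsClosed :=
  (LinearPMap.adjoint_isClosed (Zbar_dense P τ)).neg

theorem Zop_dense (P : MvPolynomial (Fin 2) ℝ) (τ : ℝ) :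
    Dense ((Zop P τ).domain : Set L2C) :=
  dense_adjoint_domain (Zbar_dense P τ) (Zbar_isClosed P τ)

theorem neg_Zop_isFormalAdjoint (P : MvPolynomial (Fin 2) ℝ) (τ : ℝ) :
    (-Zop P τ).IsFormalAdjoint (Zbar P τ) := by
  rw [Zop, neg_neg]
  exact LinearPMap.adjoint_isFormalAdjoint (Zbar_dense P τ)

theorem neg_Zbar_isFormalAdjoint (P : MvPolynomial (Fin 2) ℝ) (τ : ℝ) :
    (-Zbar P τ).IsFormalAdjoint (Zop P τ) := by
  intro x y
  have h : inner ℂ (Zbar P τ x) (y : L2C) = inner ℂ (x : L2C) (-Zop P τ y) :=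
    (neg_Zop_isFormalAdjoint P τ).symm x y
  rw [LinearPMap.neg_apply, inner_neg_left, h, inner_neg_right, neg_neg]

theorem mainTheorem6 (P : MvPolynomial (Fin 2) ℝ) (hsub : IsSubharmonic (polyFun P))
    (hnh : ¬ InnerProductSpace.HarmonicOnNhd (polyFun P) Set.univ) (τ : ℝ) (s : ℝ) (hs : 0 ≤ s) :
    (pcomp ((heatSemigroup (Box P τ) s).toPMap ⊤) (Zbar P τ) ≤
        pcomp (Zbar P τ) ((heatSemigroup (Boxw P τ) s).toPMap ⊤) ∧
      (pcomp ((heatSemigroup (Box P τ) s).toPMap ⊤) (Zbar P τ)).closure =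
        pcomp (Zbar P τ) ((heatSemigroup (Boxw P τ) s).toPMap ⊤) ∧
      (0 < s → (pcomp (Zbar P τ) ((heatSemigroup (Boxw P τ) s).toPMap ⊤)).domain = ⊤)) ∧
    (pcomp ((heatSemigroup (Boxw P τ) s).toPMap ⊤) (Zop P τ) ≤
        pcomp (Zop P τ) ((heatSemigroup (Box P τ) s).toPMap ⊤) ∧
      (pcomp ((heatSemigroup (Boxw P τ) s).toPMap ⊤) (Zop P τ)).closure =
        pcomp (Zop P τ) ((heatSemigroup (Box P τ) s).toPMap ⊤) ∧
      (0 < s → (pcomp (Zop P τ) ((heatSemigroup (Box P τ) s).toPMap ⊤)).domain = ⊤)) := by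
  -- Only formal adjointness enters, so exchanging `Z̄` and `Z` does not require `Z* = -Z̄`.
  exact ⟨heatSemigroup_intertwining (Zbar_isClosed P τ) (Zbar_dense P τ)
      (neg_Zop_isFormalAdjoint P τ) (neg_Zbar_isFormalAdjoint P τ) (isResolventOne_Boxw P τ)
      (isResolventOne_Box P τ) hs,
    heatSemigroup_intertwining (Zop_isClosed P τ) (Zop_dense P τ)
      (neg_Zbar_isFormalAdjoint P τ) (neg_Zop_isFormalAdjoint P τ) (isResolventOne_Box P τ)
      (isResolventOne_Boxw P τ) hs⟩
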